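/- Let $X$ be a two-dimensional real Banach space that is polyhedral, i.e. whose closed unit ball $B_X$ has only finitely many extreme points; let $S_X$ be its unit sphere and $\mathrm{Ext}\,B_X$ the set of extreme points of $B_X$. For $x,y\in X$ write $x\perp_B y$ if $\|x+\lambda y\|\ge\|x\|$ for all $\lambda\in\mathbb{R}$, and, for $\varepsilon\in[0,1)$, write $x\perp_B^{\varepsilon}y$ if $\|x+\lambda y\|^2\ge\|x\|^2-2\varepsilon\|x\|\,\|\lambda y\|$ for all $\lambda\in\mathbb{R}$. For $x\ne 0$ let $J(x)=\{f\in X^*:\|f\|=1,\ f(x)=\|x\|\}$. An edge of $B_X$ is a one-dimensional face of $B_X$, where a face is $B_X$ itself or a non-empty set $B_X\cap\partial M$ with $M\supseteq B_X$ a closed half-space. Then the following are equivalent: (a) (property (P1)) for all $x,y\in X$, if the closed segment $\overline{xy}$ is contained in $S_X$ and $x\perp_B y$, then $x,y\in\mathrm{Ext}\,B_X$; (b) if $x\in\mathrm{Ext}\,B_X$ and $y\in S_X$ are such that $x\perp_B y$, then $y$ does not lie in the (relative) interior of any edge of $B_X$ that contains $x$ or $-x$; (c) (local property (P) at every unit vector)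 for every $x\in S_X$ there is no $y\in S_X$ with $x\perp_B y$ such that every $f\in J(y)$ satisfies $f\in J(x)$ or $-f\in J(x)$; (d) (Birkhoff-James orthogonality is C-approximately symmetric in $X$) there exists $\varepsilon\in[0,1)$ such that for all $x,y\in X$, $x\perp_B y$ implies $y\perp_B^{\varepsilon}x$. -/

import Mathlib

namespace BJ

variable {X : Type*} [NormedAddCommGroup X] [NormedSpace ℝ X]

/-- Birkhoff-James orthogonality of `x` to `y`. -/
def Orth (x y : X) : Prop :=
  ∀ t : ℝ, ‖x‖ ≤ ‖x + t • y‖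

/-- Chmieliński's `ε`-approximate orthogonality of `x` to `y`. -/
def ApproxOrth (ε : ℝ) (x y : X) : Prop :=
  ∀ t : ℝ, ‖x‖ ^ 2 - 2 * ε * ‖x‖ * ‖t • y‖ ≤ ‖x + t • y‖ ^ 2

/-- The supporting functionals of `x` (used for `x ≠ 0`). -/
def supportFunctionals (x : X) : Set (StrongDual ℝ X) :=
  {f | ‖f‖ = 1 ∧ f x = ‖x‖}

/-- The unit vectors `y` all of whose supporting functionals are, up to sign, supporting
functionals of `x`. -/
def supportDominated (x : X) : Set X :=
  {y | ‖y‖ = 1 ∧ ∀ f ∈ supportFunctionals y,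
    f ∈ supportFunctionals x ∨ -f ∈ supportFunctionals x}

/-- The local property (P) at `x` (used for unit vectors `x`). -/
def LocalPropertyP (x : X) : Prop :=
  {y : X | Orth x y} ∩ supportDominated x = ∅

/-- A closed half-space of `X`. -/
def IsClosedHalfSpace (M : Set X) : Prop :=
  ∃ (f : StrongDual ℝ X) (c : ℝ), f ≠ 0 ∧ M = {z | f z ≤ c}

/-- A polyhedron: a nonempty compact intersection of finitely many closed half-spaces. -/
def IsPolyhedron (P : Set X) : Prop :=
  P.Nonempty ∧ IsCompact P ∧
    ∃ F : Set (Set X), F.Finite ∧ (∀ M ∈ F, IsClosedHalfSpace M) ∧ P = ⋂₀ F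

/-- `Q` is a face of the polyhedron `P`. -/
def IsFace (Q P : Set X) : Prop :=
  IsPolyhedron Q ∧
    (Q = P ∨ ∃ M : Set X, IsClosedHalfSpace M ∧ P ⊆ M ∧ Q = P ∩ frontier M)

/-- The dimension of a polyhedron: the dimension of the linear span of the differences of its
points. -/
noncomputable def polyDim (P : Set X) : ℕ :=
  Module.finrank ℝ (vectorSpan ℝ P)

/-- An edge of the polyhedron `P`: a one-dimensional face. -/
def IsEdge (Q P : Set X) : Prop :=
  IsFace Q P ∧ polyDim Q = 1

variable (X)

/-- The extreme points of the closed unit ball. -/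
def extBall : Set X :=
  Set.extremePoints ℝ (Metric.closedBall (0 : X) 1)

/-- A polyhedral space: finite-dimensional, with only finitely many extreme points of the closed
unit ball. -/
def IsPolyhedralSpace : Prop :=
  FiniteDimensional ℝ X ∧ (extBall X).Finite

/-- Property (P1). -/
def PropertyP1 : Prop :=
  ∀ x y : X, segment ℝ x y ⊆ Metric.sphere (0 : X) 1 → Orth x y →
    x ∈ extBall X ∧ y ∈ extBall X

/-- Whenever `x` is an extreme point of the unit ball and `y` is a unit vector with `x` orthogonal
to `y`, the point `y` is not in the relative interior of an edge of the unit ball that contains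
`x` or `-x`. -/
def EdgeCondition : Prop :=
  ∀ x ∈ extBall X, ∀ y ∈ Metric.sphere (0 : X) 1, Orth x y →
    ∀ L : Set X, IsEdge L (Metric.closedBall (0 : X) 1) → (x ∈ L ∨ -x ∈ L) →
      y ∉ intrinsicInterior ℝ L

/-- C-approximate symmetry of Birkhoff-James orthogonality. -/
def CApproxSymmetric : Prop :=
  ∃ ε : ℝ, 0 ≤ ε ∧ ε < 1 ∧ ∀ x y : X, Orth x y → ApproxOrth ε y x

end BJ

/-!
All four conditions say the same thing about supporting functionals. By James' theorem
(`Orth.exists_support`) `x` is orthogonal to `y` exactly when some functional supporting the unit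
ball at `x` vanishes at `y`. In a polygon a boundary point is a vertex exactly when it has more than
one supporting functional: `support_unique_of_notMem_extBall` and
`exists_ne_support_of_mem_extBall`. If unit vectors `x` and `y` lie on a common segment of the unit
sphere and `x` is orthogonal to `y`, then `x` has two supporting functionals, so it is a vertex
(`mem_extBall_of_orth`), and each of the conditions forbids `y` to lie inside the edge.

For the edge condition this is a matter of recognizing the edge as the part of the ball on a
supporting line. For the local property, a `y` inside the edge has the functional of the edge as its
only supporting functional; conversely a vertex `y` has two, and both can support the ball at `±x`
only if `y = ±x`.

For approximate symmetry, a functional `f` supporting at `y` with `|f x| ≤ ε ‖x‖` forces `y` to be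
`ε`-orthogonal to `x` (`approxOrth_of_support`). The local property gives such an `f` with
`|f x| < 1` for each pair of unit vectors, and the point is to bound these values away from one
uniformly. There are finitely many functionals cutting out edges (`finite_edgeFunctionals`), and
every functional supporting the ball at a point that is not a vertex is among them
(`mem_edgeFunctionals`). Hence either `y` belongs to a finite set, and compactness in `x` gives the
bound (`exists_bound_of_localPropertyP`), or `x` is a vertex and `f` an edge functional, which
leaves finitely many values. Conversely, if `y` is inside an edge with end `x`, the norm of
`y - s • x` is at most `1 - s` for small positive `s`, which excludes every `ε < 1`.
-/

namespace BJ

section Plane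

variable {X : Type*} [NormedAddCommGroup X] [NormedSpace ℝ X]

/-! ### Supporting functionals and orthogonality -/

lemma Orth.smul_smul {x y : X} (h : Orth x y) (a b : ℝ) : Orth (a • x) (b • y) := by
  intro t
  by_cases ha : a = 0
  · simp [ha]
  · have e : a • x + t • b • y = a • (x + (a⁻¹ * (t * b)) • y) := by
      match_scalars <;> field_simp
    rw [e, norm_smul, norm_smul]
    exact mul_le_mul_of_nonneg_left (h _) (norm_nonneg a)

/-- James' characterization of orthogonality. The functional comes from the Hahn–Banach theorem in
the quotient by the line of `y`, where the class of `x` has the same norm as `x`. -/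
lemma Orth.exists_support {x y : X} (h : Orth x y) (hx : x ≠ 0) :
    ∃ g ∈ supportFunctionals x, g y = 0 := by
  let S : Submodule ℝ X := Submodule.span ℝ {y}
  have hq : ‖(S.mkQ x : X ⧸ S)‖ = ‖x‖ := by
    refine le_antisymm (Submodule.Quotient.norm_mk_le S x) ?_
    refine QuotientAddGroup.le_norm_iff.2 fun m hm => ?_
    have hm' : m - x ∈ S := (Submodule.Quotient.eq S).1 hm
    obtain ⟨t, ht⟩ := Submodule.mem_span_singleton.1 hm'
    have : m = x + t • y := by rw [ht]; abel
    rw [this]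
    exact h t
  obtain ⟨φ, hφ, hφx⟩ := exists_dual_vector ℝ (S.mkQ x : X ⧸ S)
    (by rw [hq]; exact norm_ne_zero_iff.2 hx)
  let g : StrongDual ℝ X := (φ.toLinearMap ∘ₗ S.mkQ).mkContinuous 1 fun z => by
    calc ‖φ (S.mkQ z)‖ ≤ ‖φ‖ * ‖(S.mkQ z : X ⧸ S)‖ := φ.le_opNorm _
      _ ≤ 1 * ‖z‖ := by
        rw [hφ]
        exact mul_le_mul_of_nonneg_left (Submodule.Quotient.norm_mk_le S z) zero_le_one
  have hgx : g x = ‖x‖ := by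
    change φ (S.mkQ x) = ‖x‖
    rw [hφx, hq]; rfl
  refine ⟨g, ⟨le_antisymm (LinearMap.mkContinuous_norm_le _ zero_le_one _) ?_, hgx⟩, ?_⟩
  · have := g.le_opNorm x
    rw [hgx, norm_norm] at this
    exact le_of_mul_le_mul_right (by simpa using this) (norm_pos_iff.2 hx)
  · change φ (S.mkQ y) = 0
    have : S.mkQ y = 0 := (Submodule.Quotient.mk_eq_zero S).2 (Submodule.mem_span_singleton_self y)
    rw [this, map_zero]

lemma apply_le_one {f : StrongDual ℝ X} (hf : ‖f‖ = 1) {z : X} (hz : ‖z‖ ≤ 1) : f z ≤ 1 :=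
  (le_abs_self _).trans ((f.le_opNorm z).trans (by rw [hf, one_mul]; exact hz))

lemma abs_apply_le_norm {f : StrongDual ℝ X} (hf : ‖f‖ = 1) (z : X) : |f z| ≤ ‖z‖ :=
  (f.le_opNorm z).trans (by rw [hf, one_mul])

lemma apply_eq_one_of_mem_openSegment {f : StrongDual ℝ X} (hf : ‖f‖ = 1) {u v y : X}
    (hu : ‖u‖ ≤ 1) (hv : ‖v‖ ≤ 1) (hy : y ∈ openSegment ℝ u v) (hfy : f y = 1) :
    f u = 1 ∧ f v = 1 := by
  obtain ⟨a, b, ha, hb, hab, rfl⟩ := hy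
  simp only [map_add, map_smul, smul_eq_mul] at hfy
  have h1 := apply_le_one hf hu
  have h2 := apply_le_one hf hv
  constructor <;> nlinarith

lemma segment_subset_sphere {f : StrongDual ℝ X} (hf : ‖f‖ = 1) {x y : X}
    (hx : ‖x‖ ≤ 1) (hy : ‖y‖ ≤ 1) (hfx : f x = 1) (hfy : f y = 1) :
    segment ℝ x y ⊆ Metric.sphere (0 : X) 1 := by
  intro z hz
  have hzb : z ∈ Metric.closedBall (0 : X) 1 :=
    (convex_closedBall (0 : X) 1).segment_subset (by simpa using hx) (by simpa using hy) hz
  obtain ⟨a, b, -, -, hab, rfl⟩ := hz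
  refine mem_sphere_zero_iff_norm.2 (le_antisymm (by simpa using hzb) ?_)
  have h := abs_apply_le_norm hf (a • x + b • y)
  have e : f (a • x + b • y) = 1 := by simp [hfx, hfy, hab]
  rwa [e, abs_one] at h

/-- A segment in the unit sphere lies in a face, cut out by any functional supporting the ball at
the midpoint. -/
lemma exists_support_of_segment_subset_sphere {x y : X}
    (h : segment ℝ x y ⊆ Metric.sphere (0 : X) 1) :
    ∃ f : StrongDual ℝ X, ‖f‖ = 1 ∧ f x = 1 ∧ f y = 1 := by
  have hm : (1 / 2 : ℝ) • x + (1 / 2 : ℝ) • y ∈ openSegment ℝ x y :=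
    ⟨1 / 2, 1 / 2, by norm_num, by norm_num, by norm_num, rfl⟩
  have hmn := mem_sphere_zero_iff_norm.1 (h (openSegment_subset_segment ℝ x y hm))
  have hx := mem_sphere_zero_iff_norm.1 (h (left_mem_segment ℝ x y))
  have hy := mem_sphere_zero_iff_norm.1 (h (right_mem_segment ℝ x y))
  obtain ⟨f, hf, hfm⟩ := exists_dual_vector ℝ ((1 / 2 : ℝ) • x + (1 / 2 : ℝ) • y)
    (by rw [hmn]; exact one_ne_zero)
  rw [hmn] at hfm
  exact ⟨f, hf, apply_eq_one_of_mem_openSegment hf hx.le hy.le hm (by simpa using hfm)⟩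

lemma notMem_extBall_iff {y : X} (hy : ‖y‖ ≤ 1) :
    y ∉ extBall X ↔ ∃ u v : X, ‖u‖ ≤ 1 ∧ ‖v‖ ≤ 1 ∧ u ≠ v ∧ y ∈ openSegment ℝ u v := by
  have hyb : y ∈ Metric.closedBall (0 : X) 1 := mem_closedBall_zero_iff.2 hy
  rw [extBall, mem_extremePoints]
  constructor
  · intro h
    by_contra! hc
    refine h ⟨hyb, fun u hu v hv hyuv => ?_⟩
    have huv : u = v := by
      by_contra hne
      exact hc u v (mem_closedBall_zero_iff.1 hu) (mem_closedBall_zero_iff.1 hv) hne hyuv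
    subst huv
    rw [openSegment_same, Set.mem_singleton_iff] at hyuv
    exact ⟨hyuv.symm, hyuv.symm⟩
  · rintro ⟨u, v, hu, hv, huv, hyuv⟩ ⟨-, h⟩
    obtain ⟨h1, h2⟩ := h u (mem_closedBall_zero_iff.2 hu) v (mem_closedBall_zero_iff.2 hv) hyuv
    exact huv (h1.trans h2.symm)

lemma frontier_halfSpace {f : StrongDual ℝ X} (hf : f ≠ 0) (c : ℝ) :
    frontier {z | f z ≤ c} = {z | f z = c} := by
  have hs : Function.Surjective (f : X →ₗ[ℝ] ℝ) :=
    LinearMap.surjective fun h => hf (ContinuousLinearMap.coe_injective h)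
  have ho : IsOpenMap f := LinearMap.isOpenMap_of_finiteDimensional (f : X →ₗ[ℝ] ℝ) hs
  have h := ho.preimage_frontier_eq_frontier_preimage f.continuous (Set.Iic c)
  rw [frontier_Iic] at h
  exact h.symm

/-- The supporting hyperplane that cuts out a face misses the open unit ball. -/
lemma one_le_norm_of_mem_frontier {M : Set X} (hM : IsClosedHalfSpace M)
    (hB : Metric.closedBall (0 : X) 1 ⊆ M) {z : X} (hz : z ∈ frontier M) : 1 ≤ ‖z‖ := by
  obtain ⟨f, c, hf, rfl⟩ := hM
  rw [frontier_halfSpace hf] at hz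
  have hc : 0 ≤ c := by simpa using hB (Metric.mem_closedBall_self zero_le_one)
  have hle : ‖f‖ ≤ c := by
    refine f.opNorm_le_of_unit_norm hc fun w hw => abs_le.2 ⟨?_, ?_⟩
    · have : f (-w) ≤ c := hB (by simp [hw])
      rw [map_neg] at this
      linarith
    · exact hB (by simp [hw])
  have hpos : 0 < c := (norm_pos_iff.2 hf).trans_le hle
  have h : c ≤ c * ‖z‖ := calc
    c = f z := hz.symm
    _ ≤ ‖f‖ * ‖z‖ := (le_abs_self _).trans (f.le_opNorm z)
    _ ≤ c * ‖z‖ := mul_le_mul_of_nonneg_right hle (norm_nonneg z)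
  exact le_of_mul_le_mul_left (by simpa using h) hpos

/-! ### Planar geometry -/

lemma exists_eq_smul_add_smul (hdim : Module.finrank ℝ X = 2) {f : StrongDual ℝ X} {u v : X}
    (huv : u ≠ v) (hu : f u = 1) (hv : f v = 1) (z : X) : ∃ a b : ℝ, z = a • u + b • v := by
  have hli : LinearIndependent ℝ ![u, v] := by
    refine LinearIndependent.pair_iff.2 fun s t h => ?_
    have h1 : s + t = 0 := by simpa [hu, hv] using congrArg f h
    have h2 : s • (u - v) = 0 := by
      rw [← h, eq_neg_of_add_eq_zero_right h1]
      module
    have hs : s = 0 := (smul_eq_zero.1 h2).resolve_right (sub_ne_zero.2 huv)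
    exact ⟨hs, by linarith⟩
  have htop := hli.span_eq_top_of_card_eq_finrank (by simp [hdim])
  have hz : z ∈ Submodule.span ℝ (Set.range ![u, v]) := htop ▸ Submodule.mem_top
  rw [Matrix.range_cons_cons_empty, Submodule.mem_span_pair] at hz
  obtain ⟨a, b, h⟩ := hz
  exact ⟨a, b, h.symm⟩

lemma eq_of_apply_eq_one (hdim : Module.finrank ℝ X = 2) {f g : StrongDual ℝ X} {u v : X}
    (huv : u ≠ v) (hfu : f u = 1) (hfv : f v = 1) (hgu : g u = 1) (hgv : g v = 1) : f = g := by
  ext z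
  obtain ⟨a, b, rfl⟩ := exists_eq_smul_add_smul hdim huv hfu hfv z
  simp [hfu, hfv, hgu, hgv]

/-- The coordinates of a point in the basis formed by `x` and `y`, read off from two
functionals. -/
lemma eq_smul_add_smul (hdim : Module.finrank ℝ X = 2) {f g : StrongDual ℝ X} {x y : X}
    (hfx : f x = 1) (hfy : f y = 1) (hgx : g x = 1) (hgy : g y = 0) (z : X) :
    z = g z • x + (f z - g z) • y := by
  have hxy : x ≠ y := by
    rintro rfl
    exact one_ne_zero (hgx.symm.trans hgy)
  obtain ⟨a, b, rfl⟩ := exists_eq_smul_add_smul hdim hxy hfx hfy z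
  simp [hfx, hfy, hgx, hgy]

lemma support_unique_of_notMem_extBall (hdim : Module.finrank ℝ X = 2) {y : X} (hy : ‖y‖ = 1)
    (hne : y ∉ extBall X) {f g : StrongDual ℝ X} (hf : f ∈ supportFunctionals y)
    (hg : g ∈ supportFunctionals y) : f = g := by
  obtain ⟨u, v, hu, hv, huv, hyuv⟩ := (notMem_extBall_iff hy.le).1 hne
  obtain ⟨h1, h2⟩ := apply_eq_one_of_mem_openSegment hf.1 hu hv hyuv (hf.2.trans hy)
  obtain ⟨h3, h4⟩ := apply_eq_one_of_mem_openSegment hg.1 hu hv hyuv (hg.2.trans hy)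
  exact eq_of_apply_eq_one hdim huv h1 h2 h3 h4

lemma mem_extBall_of_orth (hdim : Module.finrank ℝ X = 2) {x y : X} {f : StrongDual ℝ X}
    (hx : ‖x‖ = 1) (hf : ‖f‖ = 1) (hfx : f x = 1) (hfy : f y = 1) (h : Orth x y) :
    x ∈ extBall X := by
  by_contra hne
  obtain ⟨g, hg, hgy⟩ := h.exists_support (norm_ne_zero_iff.1 (hx.symm ▸ one_ne_zero))
  have := support_unique_of_notMem_extBall hdim hx hne ⟨hf, hfx.trans hx.symm⟩ hg
  rw [this, hgy] at hfy
  exact zero_ne_one hfy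

/-- Near a point `y` of the unit sphere that is not extreme, the supporting line at `y` stays in the
unit ball. -/
lemma exists_forall_norm_le_one (hdim : Module.finrank ℝ X = 2) {f g : StrongDual ℝ X} {x y : X}
    (hf : ‖f‖ = 1) (hfx : f x = 1) (hfy : f y = 1) (hgx : g x = 1) (hgy : g y = 0)
    (hy : ‖y‖ ≤ 1) (hne : y ∉ extBall X) :
    ∃ δ > 0, ∀ z, f z = 1 → |g z| < δ → ‖z‖ ≤ 1 := by
  obtain ⟨u, v, hu, hv, huv, hyuv⟩ := (notMem_extBall_iff hy).1 hne
  obtain ⟨hfu, hfv⟩ := apply_eq_one_of_mem_openSegment hf hu hv hyuv hfy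
  have coord := eq_smul_add_smul hdim hfx hfy hgx hgy
  have hguv : g u ≠ g v := fun h => huv (by rw [coord u, coord v, hfu, hfv, h])
  obtain ⟨a, b, ha, hb, hab, rfl⟩ := hyuv
  simp only [map_add, map_smul, smul_eq_mul] at hgy
  have hd : 0 < |g u - g v| := abs_pos.2 (sub_ne_zero.2 hguv)
  refine ⟨min a b * |g u - g v|, mul_pos (lt_min ha hb) hd, fun z hfz hgz => ?_⟩
  -- `z` has barycentric coordinates `a + s` and `b - s` with respect to `u` and `v`.
  set s : ℝ := g z / (g u - g v) with hs
  have hsab : |s| < min a b := by rwa [hs, abs_div, div_lt_iff₀ hd]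
  have hgz' : g z = s * (g u - g v) := by rw [hs, div_mul_cancel₀ _ (sub_ne_zero.2 hguv)]
  obtain ⟨hs1, hs2⟩ := abs_lt.1 hsab
  have hza := min_le_left a b
  have hzb := min_le_right a b
  have hz : z = (a + s) • u + (b - s) • v := by
    have e : g z = g ((a + s) • u + (b - s) • v) := by
      simp only [map_add, map_smul, smul_eq_mul]
      linarith
    have e' : f z = f ((a + s) • u + (b - s) • v) := by
      simp only [map_add, map_smul, smul_eq_mul, hfu, hfv, hfz]
      linarith
    rw [coord z, coord ((a + s) • u + (b - s) • v), ← e, ← e']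
  have hmem : z ∈ segment ℝ u v :=
    ⟨a + s, b - s, by linarith, by linarith, by linarith, hz.symm⟩
  exact mem_closedBall_zero_iff.1 ((convex_closedBall (0 : X) 1).segment_subset
    (mem_closedBall_zero_iff.2 hu) (mem_closedBall_zero_iff.2 hv) hmem)

/-! ### Edges -/

lemma polyDim_closedBall :
    polyDim (Metric.closedBall (0 : X) 1) = Module.finrank ℝ X := by
  have htop : vectorSpan ℝ (Metric.closedBall (0 : X) 1) = ⊤ := by
    have hne : (interior (Metric.closedBall (0 : X) 1)).Nonempty :=
      ⟨0, mem_interior_iff_mem_nhds.2 (Metric.closedBall_mem_nhds 0 one_pos)⟩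
    rw [← direction_affineSpan, affineSpan_eq_top_of_nonempty_interior
      (hne.mono (interior_mono (subset_convexHull ℝ _))), AffineSubspace.direction_top]
  rw [polyDim, htop, finrank_top]

/-- In the plane an edge of the unit ball is a proper face, so it lies in a supporting line. -/
lemma IsEdge.exists_halfSpace (hdim : Module.finrank ℝ X = 2) {L : Set X}
    (hL : IsEdge L (Metric.closedBall (0 : X) 1)) :
    ∃ M : Set X, IsClosedHalfSpace M ∧ Metric.closedBall (0 : X) 1 ⊆ M ∧
      L = Metric.closedBall (0 : X) 1 ∩ frontier M := by
  refine hL.1.2.resolve_left ?_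
  rintro rfl
  have := hL.2
  rw [polyDim_closedBall, hdim] at this
  omega

lemma IsEdge.segment_subset_sphere (hdim : Module.finrank ℝ X = 2) {L : Set X}
    (hL : IsEdge L (Metric.closedBall (0 : X) 1)) {x y : X} (hx : x ∈ L) (hy : y ∈ L) :
    segment ℝ x y ⊆ Metric.sphere (0 : X) 1 := by
  obtain ⟨M, hM, hB, rfl⟩ := hL.exists_halfSpace hdim
  have hconv : Convex ℝ (frontier M) := by
    obtain ⟨f, c, hf, rfl⟩ := hM
    rw [frontier_halfSpace hf]
    exact convex_hyperplane f.toLinearMap.isLinear c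
  intro z hz
  refine mem_sphere_zero_iff_norm.2 (le_antisymm ?_ ?_)
  · exact mem_closedBall_zero_iff.1 ((convex_closedBall (0 : X) 1).segment_subset hx.1 hy.1 hz)
  · exact one_le_norm_of_mem_frontier hM hB (hconv.segment_subset hx.2 hy.2 hz)

lemma notMem_extBall_of_mem_intrinsicInterior {L : Set X}
    (hL : IsEdge L (Metric.closedBall (0 : X) 1)) (hB : L ⊆ Metric.closedBall (0 : X) 1) {y : X}
    (hy : y ∈ intrinsicInterior ℝ L) : y ∉ extBall X := by
  have hyL : y ∈ L := intrinsicInterior_subset hy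
  obtain ⟨w, hwL, hwy⟩ : ∃ w ∈ L, w ≠ y := by
    by_contra! h
    have hsub : L.Subsingleton := fun a ha b hb => (h a ha).trans (h b hb).symm
    have := hL.2
    rw [polyDim, (vectorSpan_eq_bot_iff_subsingleton ℝ).2 hsub, finrank_bot] at this
    exact zero_ne_one this
  obtain ⟨p, hp, rfl⟩ := mem_intrinsicInterior.1 hy
  -- The line through `y` and `w` stays in the affine span, hence in `L` for small parameters.
  let c : ℝ → affineSpan ℝ L := fun t =>
    ⟨AffineMap.lineMap (p : X) w t,
      AffineMap.lineMap_mem t p.2 (subset_affineSpan ℝ L hwL)⟩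
  have hc : Continuous c := Continuous.subtype_mk AffineMap.lineMap_continuous _
  have hc0 : c 0 = p := Subtype.ext (AffineMap.lineMap_apply_zero _ _)
  have hn : c ⁻¹' (Subtype.val ⁻¹' L) ∈ nhds (0 : ℝ) :=
    hc.continuousAt.preimage_mem_nhds (by rw [hc0]; exact mem_interior_iff_mem_nhds.1 hp)
  obtain ⟨r, hr, hball⟩ := Metric.mem_nhds_iff.1 hn
  have hmem : ∀ t : ℝ, |t| < r → ‖(p : X) + t • (w - p)‖ ≤ 1 := fun t ht => by
    have h1 : AffineMap.lineMap (p : X) w t ∈ L := hball (by simpa using ht)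
    have h2 := mem_closedBall_zero_iff.1 (hB h1)
    rwa [AffineMap.lineMap_apply_module', add_comm] at h2
  refine (notMem_extBall_iff (mem_closedBall_zero_iff.1 (hB hyL))).2
    ⟨(p : X) + (r / 2) • (w - p), (p : X) + (-(r / 2)) • (w - p), hmem _ ?_, hmem _ ?_, ?_, ?_⟩
  · rw [abs_of_pos (by linarith)]; linarith
  · rw [abs_neg, abs_of_pos (by linarith)]; linarith
  · intro h
    have h0 : r • (w - (p : X)) = 0 := by
      have := sub_eq_zero.2 h
      rw [← this]
      module
    exact (smul_eq_zero.1 h0).elim hr.ne' (sub_ne_zero.2 hwy)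
  · exact ⟨1 / 2, 1 / 2, by norm_num, by norm_num, by norm_num, by module⟩

/-- A supporting line that meets the unit ball in two points cuts out an edge. -/
lemma isEdge_inter_hyperplane (hdim : Module.finrank ℝ X = 2) {f g : StrongDual ℝ X} {x y : X}
    (hf : ‖f‖ = 1) (hfx : f x = 1) (hfy : f y = 1) (hgx : g x = 1) (hgy : g y = 0)
    (hx : ‖x‖ ≤ 1) (hy : ‖y‖ ≤ 1) :
    IsEdge (Metric.closedBall (0 : X) 1 ∩ {z | f z = 1}) (Metric.closedBall (0 : X) 1) := by
  have : FiniteDimensional ℝ X := Module.finite_of_finrank_pos (by omega)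
  have coord := eq_smul_add_smul hdim hfx hfy hgx hgy
  have hf0 : f ≠ 0 := by rintro rfl; simp at hfx
  have hg0 : g ≠ 0 := by rintro rfl; simp at hgx
  set L := Metric.closedBall (0 : X) 1 ∩ {z | f z = 1} with hLdef
  have hxL : x ∈ L := ⟨mem_closedBall_zero_iff.2 hx, hfx⟩
  have hyL : y ∈ L := ⟨mem_closedBall_zero_iff.2 hy, hfy⟩
  have hcomp : IsCompact L :=
    (isCompact_closedBall (0 : X) 1).inter_right (isClosed_eq f.continuous continuous_const)
  have hconv : Convex ℝ L :=
    (convex_closedBall (0 : X) 1).inter (convex_hyperplane f.toLinearMap.isLinear 1)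
  refine ⟨⟨⟨⟨x, hxL⟩, hcomp, ?_⟩, Or.inr ⟨{z | f z ≤ 1}, ⟨f, 1, hf0, rfl⟩, ?_, ?_⟩⟩, ?_⟩
  · -- On the line the ball is cut off where `g` attains its extreme values.
    obtain ⟨p, hpL, hp⟩ := hcomp.exists_isMinOn ⟨x, hxL⟩ g.continuous.continuousOn
    obtain ⟨q, hqL, hq⟩ := hcomp.exists_isMaxOn ⟨x, hxL⟩ g.continuous.continuousOn
    refine ⟨{{z | f z ≤ 1}, {z | (-f) z ≤ -1}, {z | g z ≤ g q}, {z | (-g) z ≤ -g p}},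
      by simp, ?_, ?_⟩
    · rintro M (rfl | rfl | rfl | rfl)
      · exact ⟨f, _, hf0, rfl⟩
      · exact ⟨-f, _, neg_ne_zero.2 hf0, rfl⟩
      · exact ⟨g, _, hg0, rfl⟩
      · exact ⟨-g, _, neg_ne_zero.2 hg0, rfl⟩
    · ext z
      simp only [Set.sInter_insert, Set.sInter_singleton, Set.mem_inter_iff, Set.mem_ofPred_eq,
        neg_apply, neg_le_neg_iff]
      constructor
      · intro hz
        exact ⟨hz.2.le, hz.2.ge, hq hz, hp hz⟩
      · rintro ⟨h1, h2, h3, h4⟩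
        have hfz : f z = 1 := le_antisymm h1 h2
        have hseg : g z ∈ segment ℝ (g p) (g q) := by
          rw [segment_eq_Icc (h4.trans h3)]
          exact ⟨h4, h3⟩
        obtain ⟨a, b, ha, hb, hab, hz⟩ := hseg
        have e : z = a • p + b • q := by
          have e1 : g (a • p + b • q) = g z := by rw [← hz]; simp
          have e2 : f (a • p + b • q) = f z := by
            have hfp : f p = 1 := hpL.2
            have hfq : f q = 1 := hqL.2
            simp [hfp, hfq, hfz, hab]
          rw [coord z, coord (a • p + b • q), e1, e2]
        rw [e]
        exact hconv hpL hqL ha hb hab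
  · exact fun z hz => apply_le_one hf (mem_closedBall_zero_iff.1 hz)
  · rw [frontier_halfSpace hf0]
  · have hspan : vectorSpan ℝ L = Submodule.span ℝ {x - y} := by
      apply le_antisymm
      · refine Submodule.span_le.2 ?_
        rintro _ ⟨z, hz, w, hw, rfl⟩
        refine Submodule.mem_span_singleton.2 ⟨g z - g w, ?_⟩
        have hfz : f z = 1 := hz.2
        have hfw : f w = 1 := hw.2
        change _ = z - w
        rw [coord z, coord w]
        simp only [map_add, map_smul, smul_eq_mul, hgx, hgy, hfz, hfw]
        module
      · exact (Submodule.span_singleton_le_iff_mem _ _).2 (vsub_mem_vectorSpan ℝ hxL hyL)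
    rw [polyDim, hspan, finrank_span_singleton]
    rintro h
    rw [sub_eq_zero.1 h] at hgx
    exact one_ne_zero (hgx.symm.trans hgy)

lemma mem_intrinsicInterior_inter_hyperplane {f g : StrongDual ℝ X} {y : X} (hfy : f y = 1)
    (hgy : g y = 0) (hy : ‖y‖ ≤ 1) {δ : ℝ} (hδ : 0 < δ)
    (h : ∀ z, f z = 1 → |g z| < δ → ‖z‖ ≤ 1) :
    y ∈ intrinsicInterior ℝ (Metric.closedBall (0 : X) 1 ∩ {z | f z = 1}) := by
  set L := Metric.closedBall (0 : X) 1 ∩ {z | f z = 1} with hLdef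
  have hyL : y ∈ L := ⟨mem_closedBall_zero_iff.2 hy, hfy⟩
  have hspan : ∀ z ∈ affineSpan ℝ L, f z = 1 := fun z hz => by
    have hdir : z - y ∈ vectorSpan ℝ L := by
      rw [← direction_affineSpan]
      exact AffineSubspace.vsub_mem_direction hz (subset_affineSpan ℝ L hyL)
    have hle : vectorSpan ℝ L ≤ f.toLinearMap.ker := by
      refine Submodule.span_le.2 ?_
      rintro _ ⟨a, ha, b, hb, rfl⟩
      have hfa : f a = 1 := ha.2
      have hfb : f b = 1 := hb.2
      change f (a - b) = 0
      rw [map_sub, hfa, hfb, sub_self]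
    have h0 : f (z - y) = 0 := hle hdir
    rw [map_sub, hfy] at h0
    linarith
  refine mem_intrinsicInterior.2 ⟨⟨y, subset_affineSpan ℝ L hyL⟩, ?_, rfl⟩
  refine mem_interior.2 ⟨{z | |g (z : X)| < δ}, ?_, ?_, ?_⟩
  · intro z hz
    exact ⟨mem_closedBall_zero_iff.2 (h z (hspan z z.2) hz), hspan z z.2⟩
  · exact isOpen_lt (g.continuous.comp continuous_subtype_val).abs continuous_const
  · simpa [hgy] using hδ

/-! ### Polyhedral unit balls -/

lemma convexHull_extBall (h : IsPolyhedralSpace X) :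
    convexHull ℝ (extBall X) = Metric.closedBall (0 : X) 1 := by
  have := h.1
  rw [← (h.2.isClosed_convexHull ℝ).closure_eq]
  exact closure_convexHull_extremePoints (isCompact_closedBall (0 : X) 1)
    (convex_closedBall (0 : X) 1)

lemma norm_le_one_of_forall_extBall (h : IsPolyhedralSpace X) {f : StrongDual ℝ X}
    (hf : ∀ e ∈ extBall X, f e ≤ 1) : ‖f‖ ≤ 1 := by
  have hB : ∀ z : X, ‖z‖ ≤ 1 → f z ≤ 1 := fun z hz => by
    have hsub : convexHull ℝ (extBall X) ⊆ {z | f z ≤ 1} :=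
      convexHull_min hf (convex_halfSpace_le f.toLinearMap.isLinear 1)
    rw [convexHull_extBall h] at hsub
    exact hsub (mem_closedBall_zero_iff.2 hz)
  refine f.opNorm_le_of_unit_norm zero_le_one fun z hz => abs_le.2 ⟨?_, hB z hz.le⟩
  have := hB (-z) (by rw [norm_neg, hz])
  rw [map_neg] at this
  linarith

/-- A vertex of a polygon is not a smooth point: a functional that strictly separates it from the
other vertices may be perturbed. -/
lemma exists_ne_support_of_mem_extBall (hdim : Module.finrank ℝ X = 2) (h : IsPolyhedralSpace X)
    {y : X} (hy : ‖y‖ = 1) (hye : y ∈ extBall X) :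
    ∃ f ∈ supportFunctionals y, ∃ g ∈ supportFunctionals y, f ≠ g := by
  have := h.1
  have hfin : (extBall X \ {y}).Finite := h.2.subset Set.sdiff_subset
  have hnot : y ∉ convexHull ℝ (extBall X \ {y}) := fun hmem => by
    have hsub : convexHull ℝ (extBall X \ {y}) ⊆ Metric.closedBall (0 : X) 1 :=
      (convexHull_mono Set.sdiff_subset).trans (convexHull_extBall h).subset
    have : y ∈ Set.extremePoints ℝ (convexHull ℝ (extBall X \ {y})) :=
      inter_extremePoints_subset_extremePoints_of_subset hsub ⟨hmem, hye⟩
    exact (extremePoints_convexHull_subset this).2 rfl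
  obtain ⟨k, c, hky, hkc⟩ := geometric_hahn_banach_point_closed (convex_convexHull ℝ _)
    (hfin.isClosed_convexHull ℝ) hnot
  have hk : ∀ e ∈ extBall X \ {y}, k y < k e := fun e he =>
    hky.trans (hkc e (subset_convexHull ℝ _ he))
  obtain ⟨m, hm0, hmy⟩ : ∃ m : StrongDual ℝ X, m ≠ 0 ∧ m y = 0 := by
    have hlt : Submodule.span ℝ {y} < ⊤ := by
      refine lt_top_iff_ne_top.2 fun htop => ?_
      have h1 : Module.finrank ℝ (Submodule.span ℝ {y}) ≤ 1 := by
        simpa using finrank_span_le_card (R := ℝ) ({y} : Set X)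
      rw [htop, finrank_top, hdim] at h1
      omega
    obtain ⟨φ, hφ, hle⟩ := Submodule.exists_le_ker_of_lt_top _ hlt
    refine ⟨LinearMap.toContinuousLinearMap φ, fun h0 => hφ ?_,
      hle (Submodule.mem_span_singleton_self y)⟩
    exact (LinearEquiv.map_eq_zero_iff LinearMap.toContinuousLinearMap).1 h0
  -- All the finitely many strict inequalities survive a small perturbation of `k` by `m`.
  obtain ⟨δ, hδ, hδk⟩ : ∃ δ > 0, ∀ e ∈ extBall X \ {y}, k y < k e + δ * m e := by
    have hev : ∀ᶠ δ in nhdsWithin (0 : ℝ) (Set.Ioi 0),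
        ∀ e ∈ extBall X \ {y}, k y < k e + δ * m e := by
      refine (Set.Finite.eventually_all hfin).2 fun e he => ?_
      have ht : Filter.Tendsto (fun δ : ℝ => k e + δ * m e) (nhds 0) (nhds (k e + 0 * m e)) :=
        (by fun_prop : Continuous fun δ : ℝ => k e + δ * m e).tendsto 0
      exact (ht.eventually (lt_mem_nhds (by simpa using hk e he))).filter_mono nhdsWithin_le_nhds
    obtain ⟨δ, h1, h2⟩ := (hev.and self_mem_nhdsWithin).exists
    exact ⟨δ, h2, h1⟩
  have hneg : k y < 0 := by
    by_contra! hc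
    have hsub : convexHull ℝ (extBall X) ⊆ {z | 0 ≤ k z} :=
      convexHull_min (fun e he => by
        by_cases hey : e = y
        · rw [hey]; exact hc
        · exact hc.trans (hk e ⟨he, hey⟩).le) (convex_halfSpace_ge k.toLinearMap.isLinear 0)
    rw [convexHull_extBall h] at hsub
    have hk0 : ∀ z : X, ‖z‖ ≤ 1 → k z = 0 := fun z hz => by
      have h1 : 0 ≤ k z := hsub (mem_closedBall_zero_iff.2 hz)
      have h2 : 0 ≤ k (-z) := hsub (mem_closedBall_zero_iff.2 (by rwa [norm_neg]))
      rw [map_neg] at h2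
      linarith
    -- Since `k` vanishes, `y` is the only extreme point and the ball is a point.
    have hE : extBall X ⊆ {y} := fun e he => by
      by_contra hey
      have := hk e ⟨he, hey⟩
      rw [hk0 y hy.le, hk0 e (mem_closedBall_zero_iff.1 he.1)] at this
      exact lt_irrefl _ this
    have hB : convexHull ℝ (extBall X) ⊆ {y} := convexHull_min hE (convex_singleton y)
    rw [convexHull_extBall h] at hB
    have h0 : (0 : X) = y := hB (Metric.mem_closedBall_self zero_le_one)
    rw [← h0, norm_zero] at hy
    exact zero_ne_one hy
  have hsupp : ∀ k' : StrongDual ℝ X, k' y = k y → (∀ e ∈ extBall X \ {y}, k y < k' e) →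
      (k y)⁻¹ • k' ∈ supportFunctionals y := fun k' hk'y hk' => by
    have hval : ((k y)⁻¹ • k') y = 1 := by simp [hk'y, hneg.ne]
    refine ⟨le_antisymm (norm_le_one_of_forall_extBall h fun e he => ?_) ?_, hval.trans hy.symm⟩
    · by_cases hey : e = y
      · rw [hey, hval]
      · have h1 := hk' e ⟨he, hey⟩
        change (k y)⁻¹ * k' e ≤ 1
        calc (k y)⁻¹ * k' e ≤ (k y)⁻¹ * k y :=
              mul_le_mul_of_nonpos_left h1.le (inv_lt_zero.2 hneg).le
          _ = 1 := inv_mul_cancel₀ hneg.ne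
    · have := ((k y)⁻¹ • k').le_opNorm y
      rwa [hval, hy, mul_one, norm_one] at this
  refine ⟨_, hsupp k rfl hk, _, hsupp (k + δ • m) (by simp [hmy]) (by simpa using hδk), ?_⟩
  intro heq
  have h1 : k = k + δ • m := smul_right_injective _ (inv_ne_zero hneg.ne) heq
  exact smul_ne_zero hδ.ne' hm0 (left_eq_add.1 h1)

variable (X) in
/-- The functionals of norm one that take the value one at two distinct extreme points of the unit
ball: in the plane, these are the functionals that cut out the edges of the unit ball. -/
def edgeFunctionals : Set (StrongDual ℝ X) :=
  {f | ‖f‖ = 1 ∧ ∃ u ∈ extBall X, ∃ v ∈ extBall X, u ≠ v ∧ f u = 1 ∧ f v = 1}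

lemma finite_edgeFunctionals (hdim : Module.finrank ℝ X = 2) (h : IsPolyhedralSpace X) :
    (edgeFunctionals X).Finite := by
  refine (h.2.biUnion (t := fun u => ⋃ v ∈ extBall X,
    {f : StrongDual ℝ X | u ≠ v ∧ f u = 1 ∧ f v = 1}) fun u _ => h.2.biUnion fun v _ => ?_).subset ?_
  · refine Set.Subsingleton.finite ?_
    rintro f ⟨huv, hfu, hfv⟩ g ⟨-, hgu, hgv⟩
    exact eq_of_apply_eq_one hdim huv hfu hfv hgu hgv
  · rintro f ⟨-, u, hu, v, hv, huv⟩
    exact Set.mem_biUnion hu (Set.mem_biUnion hv huv)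

/-- The face cut out by a functional supporting the ball at a point that is not extreme has at least
two extreme points by the Krein–Milman theorem, and these are extreme in the ball. -/
lemma mem_edgeFunctionals [FiniteDimensional ℝ X] {y : X} (hy : ‖y‖ = 1) (hne : y ∉ extBall X)
    {f : StrongDual ℝ X} (hf : f ∈ supportFunctionals y) : f ∈ edgeFunctionals X := by
  set F := Metric.closedBall (0 : X) 1 ∩ {z | f z = 1} with hF
  have hcomp : IsCompact F :=
    (isCompact_closedBall (0 : X) 1).inter_right (isClosed_eq f.continuous continuous_const)
  have hconv : Convex ℝ F :=
    (convex_closedBall (0 : X) 1).inter (convex_hyperplane f.toLinearMap.isLinear 1)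
  have hfy : f y = 1 := hf.2.trans hy
  have hyF : y ∈ F := ⟨mem_closedBall_zero_iff.2 hy.le, hfy⟩
  have hexp : IsExposed ℝ (Metric.closedBall (0 : X) 1) F := fun _ => by
    refine ⟨f, Set.ext fun z => ⟨fun hz => ⟨hz.1, fun w hw => ?_⟩, fun hz => ⟨hz.1, ?_⟩⟩⟩
    · have hfz : f z = 1 := hz.2
      rw [hfz]
      exact apply_le_one hf.1 (mem_closedBall_zero_iff.1 hw)
    · refine le_antisymm (apply_le_one hf.1 (mem_closedBall_zero_iff.1 hz.1)) ?_
      rw [← hfy]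
      exact hz.2 y hyF.1
  have hsub : Set.extremePoints ℝ F ⊆ extBall X :=
    hexp.isExtreme.extremePoints_subset_extremePoints
  by_contra hcon
  have hsing : (Set.extremePoints ℝ F).Subsingleton := fun u hu v hv => by
    by_contra huv
    exact hcon ⟨hf.1, u, hsub hu, v, hsub hv, huv, hu.1.2, hv.1.2⟩
  have hKM := closure_convexHull_extremePoints hcomp hconv
  rcases hsing.eq_empty_or_singleton with h0 | ⟨u, hu⟩
  · rw [h0, convexHull_empty, closure_empty] at hKM
    rw [← hKM] at hyF
    exact hyF
  · rw [hu, convexHull_singleton, closure_singleton] at hKM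
    rw [← hKM] at hyF
    refine hne (hsub ?_)
    rw [hu]
    exact hyF

/-! ### Approximate orthogonality -/

lemma approxOrth_of_support {ε : ℝ} {x y : X} {f : StrongDual ℝ X} (hf : f ∈ supportFunctionals y)
    (h : |f x| ≤ ε * ‖x‖) : ApproxOrth ε y x := by
  intro t
  have h1 : |‖y‖ + t * f x| ≤ ‖y + t • x‖ := by
    have := abs_apply_le_norm hf.1 (y + t • x)
    rwa [map_add, map_smul, hf.2, smul_eq_mul] at this
  have h2 : (‖y‖ + t * f x) ^ 2 ≤ ‖y + t • x‖ ^ 2 := by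
    rw [← sq_abs]
    exact pow_le_pow_left₀ (abs_nonneg _) h1 2
  have h3 : -(|t| * (ε * ‖x‖)) ≤ t * f x := by
    have : |t * f x| ≤ |t| * (ε * ‖x‖) := by
      rw [abs_mul]
      exact mul_le_mul_of_nonneg_left h (abs_nonneg t)
    exact (abs_le.1 this).1
  have h4 := mul_le_mul_of_nonneg_left h3 (norm_nonneg y)
  rw [norm_smul, Real.norm_eq_abs]
  nlinarith [sq_nonneg (t * f x)]

lemma isClosed_setOf_orth (y : X) : IsClosed {x : X | Orth x y} := by
  simp only [Orth, Set.ofPred_forall]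
  exact isClosed_iInter fun t => isClosed_le continuous_norm (by fun_prop)

lemma LocalPropertyP.exists_abs_lt_one {x y : X} (h : LocalPropertyP x) (hx : ‖x‖ = 1)
    (hy : ‖y‖ = 1) (hxy : Orth x y) : ∃ f ∈ supportFunctionals y, |f x| < 1 := by
  by_contra! hc
  refine Set.eq_empty_iff_forall_notMem.1 h y ⟨hxy, hy, fun f hf => ?_⟩
  have h1 : |f x| = 1 := le_antisymm ((abs_apply_le_norm hf.1 x).trans hx.le) (hc f hf)
  rcases eq_or_eq_neg_of_abs_eq h1 with h2 | h2
  · exact Or.inl ⟨hf.1, h2.trans hx.symm⟩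
  · exact Or.inr ⟨(norm_neg f).trans hf.1, by
      rw [neg_apply, h2, neg_neg, hx]⟩

lemma exists_uniform_bound_of_finite {α : Type*} {S : Set α} (hS : S.Finite) (P : α → ℝ → Prop)
    (hmono : ∀ a s t, s ≤ t → P a s → P a t) (h : ∀ a ∈ S, ∃ ε < 1, P a ε) :
    ∃ ε, 0 ≤ ε ∧ ε < 1 ∧ ∀ a ∈ S, P a ε := by
  induction S, hS using Set.Finite.induction_on with
  | empty => exact ⟨0, le_rfl, one_pos, by simp⟩
  | @insert a S _ _ ih =>
    obtain ⟨ε, h0, h1, hε⟩ := ih fun b hb => h b (Set.mem_insert_of_mem _ hb)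
    obtain ⟨η, hη1, hη⟩ := h a (Set.mem_insert _ _)
    refine ⟨max ε η, h0.trans (le_max_left _ _), max_lt h1 hη1, ?_⟩
    rintro b (rfl | hb)
    · exact hmono _ _ _ (le_max_right _ _) hη
    · exact hmono _ _ _ (le_max_left _ _) (hε b hb)

/-- For a fixed `y`, compactness of the set of unit vectors orthogonal to `y` makes the bound in
the local property uniform. -/
lemma exists_bound_of_localPropertyP [FiniteDimensional ℝ X]
    (h : ∀ x ∈ Metric.sphere (0 : X) 1, LocalPropertyP x) {y : X} (hy : ‖y‖ = 1) :
    ∃ ε < 1, ∀ x : X, ‖x‖ = 1 → Orth x y → ∃ f ∈ supportFunctionals y, |f x| ≤ ε := by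
  have hK : IsCompact (Metric.sphere (0 : X) 1 ∩ {x | Orth x y}) :=
    (isCompact_sphere (0 : X) 1).inter_right (isClosed_setOf_orth y)
  obtain ⟨ε, hε, hK'⟩ : ∃ ε < 1, ∀ x ∈ Metric.sphere (0 : X) 1 ∩ {x | Orth x y},
      ∃ f ∈ supportFunctionals y, |f x| ≤ ε := by
    refine hK.induction_on (p := fun s => ∃ ε < (1 : ℝ), ∀ x ∈ s,
      ∃ f ∈ supportFunctionals y, |f x| ≤ ε) ⟨0, one_pos, by simp⟩ ?_ ?_ ?_
    · rintro s t hst ⟨ε, hε, ht⟩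
      exact ⟨ε, hε, fun x hx => ht x (hst hx)⟩
    · rintro s t ⟨ε, hε, hs⟩ ⟨η, hη, ht⟩
      refine ⟨max ε η, max_lt hε hη, ?_⟩
      rintro x (hx | hx)
      · obtain ⟨f, hf, hfx⟩ := hs x hx
        exact ⟨f, hf, hfx.trans (le_max_left _ _)⟩
      · obtain ⟨f, hf, hfx⟩ := ht x hx
        exact ⟨f, hf, hfx.trans (le_max_right _ _)⟩
    · rintro x ⟨hx, hxy⟩
      obtain ⟨f, hf, hfx⟩ := (h x hx).exists_abs_lt_one (mem_sphere_zero_iff_norm.1 hx) hy hxy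
      obtain ⟨ε, h1, h2⟩ := exists_between hfx
      have ho : IsOpen {z : X | |f z| < ε} := isOpen_lt f.continuous.abs continuous_const
      exact ⟨_, mem_nhdsWithin_of_mem_nhds (ho.mem_nhds h1), ε, h2, fun z hz => ⟨f, hf, le_of_lt hz⟩⟩
  exact ⟨ε, hε, fun x hx hxy => hK' x ⟨mem_sphere_zero_iff_norm.2 hx, hxy⟩⟩

/-! ### The implications -/

theorem PropertyP1.edgeCondition (hdim : Module.finrank ℝ X = 2) (h : PropertyP1 X) :
    EdgeCondition X := by
  intro x _ y _ hxy L hL hxL hyint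
  have hyL : y ∈ L := intrinsicInterior_subset hyint
  have hLB : L ⊆ Metric.closedBall (0 : X) 1 := by
    obtain ⟨M, -, -, rfl⟩ := hL.exists_halfSpace hdim
    exact Set.inter_subset_left
  refine notMem_extBall_of_mem_intrinsicInterior hL hLB hyint ?_
  rcases hxL with hx | hx
  · exact (h x y (hL.segment_subset_sphere hdim hx hyL) hxy).2
  · exact (h (-x) y (hL.segment_subset_sphere hdim hx hyL)
      (by simpa using hxy.smul_smul (-1) 1)).2

theorem EdgeCondition.propertyP1 (hdim : Module.finrank ℝ X = 2) (h : EdgeCondition X) :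
    PropertyP1 X := by
  intro x y hseg hxy
  have hxS := hseg (left_mem_segment ℝ x y)
  have hyS := hseg (right_mem_segment ℝ x y)
  have hx := mem_sphere_zero_iff_norm.1 hxS
  have hy := mem_sphere_zero_iff_norm.1 hyS
  obtain ⟨f, hf, hfx, hfy⟩ := exists_support_of_segment_subset_sphere hseg
  have hxe := mem_extBall_of_orth hdim hx hf hfx hfy hxy
  refine ⟨hxe, ?_⟩
  by_contra hne
  obtain ⟨g, hg, hgy⟩ := hxy.exists_support (norm_ne_zero_iff.1 (hx.symm ▸ one_ne_zero))
  have hgx : g x = 1 := hg.2.trans hx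
  obtain ⟨δ, hδ, hball⟩ := exists_forall_norm_le_one hdim hf hfx hfy hgx hgy hy.le hne
  exact h x hxe y hyS hxy _ (isEdge_inter_hyperplane hdim hf hfx hfy hgx hgy hx.le hy.le)
    (Or.inl ⟨mem_closedBall_zero_iff.2 hx.le, hfx⟩)
    (mem_intrinsicInterior_inter_hyperplane hfy hgy hy.le hδ hball)

theorem PropertyP1.localPropertyP (hdim : Module.finrank ℝ X = 2) (hpoly : IsPolyhedralSpace X)
    (h : PropertyP1 X) {x : X} (hx : ‖x‖ = 1) : LocalPropertyP x := by
  refine Set.eq_empty_iff_forall_notMem.2 ?_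
  rintro y ⟨hxy, hy, hdom⟩
  have hxy : Orth x y := hxy
  have hy0 : y ≠ 0 := norm_ne_zero_iff.1 (hy.symm ▸ one_ne_zero)
  have habs : ∀ f ∈ supportFunctionals y, f x = 1 ∨ f (-x) = 1 := fun f hf => by
    rcases hdom f hf with h1 | h1
    · exact Or.inl (h1.2.trans hx)
    · exact Or.inr (by rw [map_neg]; exact h1.2.trans hx)
  have hext : y ∈ extBall X := by
    obtain ⟨f, hf, hfy⟩ := exists_dual_vector ℝ y (norm_ne_zero_iff.2 hy0)
    have hfy1 : f y = 1 := by rw [hfy, hy]; rfl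
    rcases habs f ⟨hf, hfy⟩ with h1 | h1
    · exact (h x y (segment_subset_sphere hf hx.le hy.le h1 hfy1) hxy).2
    · exact (h (-x) y (segment_subset_sphere hf (by rw [norm_neg, hx]) hy.le h1 hfy1)
        (by simpa using hxy.smul_smul (-1) 1)).2
  obtain ⟨f, hf, g, hg, hfg⟩ := exists_ne_support_of_mem_extBall hdim hpoly hy hext
  have hfy : f y = 1 := hf.2.trans hy
  have hgy : g y = 1 := hg.2.trans hy
  -- Two functionals agreeing at `y` and at `±x` are equal unless `y = ±x`, which is not orthogonal
  -- to `x`.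
  have hne : ∀ s : ℝ, s ≠ 0 → s • x ≠ y := fun s hs hsx => by
    have h0 := hxy (-s⁻¹)
    rw [← hsx, smul_smul, neg_mul, inv_mul_cancel₀ hs, neg_one_smul, add_neg_cancel, norm_zero,
      hx] at h0
    linarith
  have hne1 : x ≠ y := by simpa using hne 1 one_ne_zero
  have hne2 : -x ≠ y := by simpa using hne (-1) (by norm_num)
  have avg : ∀ f ∈ supportFunctionals y, ∀ g ∈ supportFunctionals y,
      f x = 1 → g (-x) = 1 → False := fun f hf g hg h1 h2 => by
    -- The average of `f` and `g` supports the ball at `y` and vanishes at `x`.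
    have hv : ((1 / 2 : ℝ) • (f + g)) y = 1 := by
      simp only [smul_apply, add_apply, smul_eq_mul, hf.2, hg.2, hy]
      norm_num
    have hm : (1 / 2 : ℝ) • (f + g) ∈ supportFunctionals y := by
      refine ⟨le_antisymm ?_ ?_, hv.trans hy.symm⟩
      · have := norm_add_le f g
        rw [hf.1, hg.1] at this
        rw [norm_smul, Real.norm_of_nonneg (by norm_num)]
        linarith
      · have := ((1 / 2 : ℝ) • (f + g)).le_opNorm y
        rwa [hv, hy, mul_one, norm_one] at this
    rw [map_neg] at h2
    have hz : ((1 / 2 : ℝ) • (f + g)) x = 0 := by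
      simp only [smul_apply, add_apply, smul_eq_mul]
      linarith
    rcases habs _ hm with h3 | h3
    · linarith
    · rw [map_neg] at h3
      linarith
  rcases habs f hf with h1 | h1 <;> rcases habs g hg with h2 | h2
  · exact hfg (eq_of_apply_eq_one hdim hne1 h1 hfy h2 hgy)
  · exact avg f hf g hg h1 h2
  · exact avg g hg f hf h2 h1
  · exact hfg (eq_of_apply_eq_one hdim hne2 h1 hfy h2 hgy)

/-- Let `x` and `y` be unit vectors with `x` orthogonal to `y`. If neither is extreme, then one edge
functional is one at `y` and another vanishes there, which leaves finitely many `y`; extreme `y` are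
finitely many as well, and each fixed `y` has a uniform bound. If `x` is extreme and `y` is not, the
functional `f` supporting at `y` is an edge functional, so only finitely many values `f x` occur. -/
theorem cApproxSymmetric_of_localPropertyP (hdim : Module.finrank ℝ X = 2)
    (hpoly : IsPolyhedralSpace X) (h : ∀ x ∈ Metric.sphere (0 : X) 1, LocalPropertyP x) :
    CApproxSymmetric X := by
  have := hpoly.1
  have hΦ := finite_edgeFunctionals hdim hpoly
  set Y : Set X := {y | ∃ f ∈ edgeFunctionals X, ∃ g ∈ edgeFunctionals X, f y = 1 ∧ g y = 0}
    with hYdef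
  have hY : Y.Finite := by
    refine (hΦ.biUnion (t := fun f => ⋃ g ∈ edgeFunctionals X, {y : X | f y = 1 ∧ g y = 0})
      fun f _ => hΦ.biUnion fun g hg => ?_).subset ?_
    · refine Set.Subsingleton.finite ?_
      rintro y ⟨hfy, hgy⟩ z ⟨hfz, hgz⟩
      by_contra hyz
      have hg0 : g = 0 := by
        ext w
        obtain ⟨a, b, rfl⟩ := exists_eq_smul_add_smul hdim hyz hfy hfz w
        simp [hgy, hgz]
      have := hg.1
      rw [hg0, norm_zero] at this
      exact zero_ne_one this
    · rintro y ⟨f, hf, g, hg, hy⟩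
      exact Set.mem_biUnion hf (Set.mem_biUnion hg hy)
  obtain ⟨ε, hε0, hε1, hε⟩ := exists_uniform_bound_of_finite (hpoly.2.union hY)
    (fun y s => ‖y‖ = 1 → ∀ x : X, ‖x‖ = 1 → Orth x y → ∃ f ∈ supportFunctionals y, |f x| ≤ s)
    (fun y s t hst hs hy x hx hxy => by
      obtain ⟨f, hf, hfx⟩ := hs hy x hx hxy
      exact ⟨f, hf, hfx.trans hst⟩)
    (fun y _ => by
      by_cases hy : ‖y‖ = 1
      · obtain ⟨s, hs, hb⟩ := exists_bound_of_localPropertyP h hy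
        exact ⟨s, hs, fun _ => hb⟩
      · exact ⟨0, one_pos, fun hy' => absurd hy' hy⟩)
  obtain ⟨η, hη0, hη1, hη⟩ := exists_uniform_bound_of_finite (hpoly.2.prod hΦ)
    (fun p s => |p.2 p.1| < 1 → |p.2 p.1| ≤ s) (fun p s t hst hs hp => (hs hp).trans hst)
    (fun p _ => by
      by_cases hp : |p.2 p.1| < 1
      · exact ⟨_, hp, fun _ => le_rfl⟩
      · exact ⟨0, one_pos, fun hp' => absurd hp' hp⟩)
  have key : ∀ x y : X, ‖x‖ = 1 → ‖y‖ = 1 → Orth x y →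
      ∃ f ∈ supportFunctionals y, |f x| ≤ max ε η := fun x y hx hy hxy => by
    by_cases hyE : y ∈ extBall X ∪ Y
    · obtain ⟨f, hf, hfx⟩ := hε y hyE hy x hx hxy
      exact ⟨f, hf, hfx.trans (le_max_left _ _)⟩
    · have hye : y ∉ extBall X := fun hc => hyE (Or.inl hc)
      obtain ⟨f, hf, hfx⟩ :=
        (h x (mem_sphere_zero_iff_norm.2 hx)).exists_abs_lt_one hx hy hxy
      have hfΦ := mem_edgeFunctionals hy hye hf
      have hxe : x ∈ extBall X := by
        by_contra hxe
        obtain ⟨g, hg, hgy⟩ := hxy.exists_support (norm_ne_zero_iff.1 (hx.symm ▸ one_ne_zero))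
        exact hyE (Or.inr ⟨f, hfΦ, g, mem_edgeFunctionals hx hxe hg, hf.2.trans hy, hgy⟩)
      exact ⟨f, hf, (hη (x, f) ⟨hxe, hfΦ⟩ hfx).trans (le_max_right _ _)⟩
  refine ⟨max ε η, hε0.trans (le_max_left _ _), max_lt hε1 hη1, fun x y hxy => ?_⟩
  rcases eq_or_ne x 0 with rfl | hx0
  · intro t
    simp
  rcases eq_or_ne y 0 with rfl | hy0
  · intro t
    simp
  have hxn := norm_pos_iff.2 hx0
  have hyn := norm_pos_iff.2 hy0
  obtain ⟨f, hf, hfx⟩ := key (‖x‖⁻¹ • x) (‖y‖⁻¹ • y) (norm_smul_inv_norm hx0)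
    (norm_smul_inv_norm hy0) (hxy.smul_smul _ _)
  refine approxOrth_of_support (f := f) ⟨hf.1, ?_⟩ ?_
  · have h1 := hf.2.trans (norm_smul_inv_norm (𝕜 := ℝ) hy0)
    rw [map_smul, smul_eq_mul, inv_mul_eq_one₀ hyn.ne'] at h1
    exact h1.symm
  · rw [map_smul, smul_eq_mul, abs_mul, abs_inv, abs_norm, inv_mul_le_iff₀ hxn, mul_comm] at hfx
    exact hfx

/-- If `y` is not extreme, moving from `y` away from `x` along the supporting line stays in the ball
for a while, so the norm of `y - s • x` drops at the full rate `1 - s`. -/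
theorem CApproxSymmetric.propertyP1 (hdim : Module.finrank ℝ X = 2) (h : CApproxSymmetric X) :
    PropertyP1 X := by
  intro x y hseg hxy
  have hx := mem_sphere_zero_iff_norm.1 (hseg (left_mem_segment ℝ x y))
  have hy := mem_sphere_zero_iff_norm.1 (hseg (right_mem_segment ℝ x y))
  obtain ⟨f, hf, hfx, hfy⟩ := exists_support_of_segment_subset_sphere hseg
  refine ⟨mem_extBall_of_orth hdim hx hf hfx hfy hxy, ?_⟩
  by_contra hne
  obtain ⟨g, hg, hgy⟩ := hxy.exists_support (norm_ne_zero_iff.1 (hx.symm ▸ one_ne_zero))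
  have hgx : g x = 1 := hg.2.trans hx
  obtain ⟨δ, hδ, hball⟩ := exists_forall_norm_le_one hdim hf hfx hfy hgx hgy hy.le hne
  obtain ⟨ε, hε0, hε1, happ⟩ := h
  obtain ⟨r, hr0, hr⟩ := exists_between (lt_min hδ (sub_pos.2 hε1))
  obtain ⟨hrδ, hrε⟩ := lt_min_iff.1 hr
  have hr1 : 0 < 1 + r := by linarith
  -- The point `(1 + r) • y - r • x` of the supporting line is `1 + r` times `y - s • x`.
  have hz : ‖(1 + r) • y - r • x‖ ≤ 1 := by
    refine hball _ (by simp [hfx, hfy]) ?_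
    simpa [hgx, hgy, abs_of_pos hr0] using hrδ
  set s := r / (1 + r) with hs
  have hs0 : 0 < s := div_pos hr0 hr1
  have hsr : s ≤ r := div_le_self hr0.le (by linarith)
  have hinv : (1 + r)⁻¹ = 1 - s := by rw [hs]; field_simp; ring
  have hz' : ‖y + (-s) • x‖ ≤ 1 - s := by
    have e : y + (-s) • x = (1 + r)⁻¹ • ((1 + r) • y - r • x) := by
      rw [smul_sub, inv_smul_smul₀ hr1.ne', smul_smul, neg_smul, ← sub_eq_add_neg, hs,
        div_eq_inv_mul]
    rw [e, norm_smul, ← hinv, Real.norm_of_nonneg (inv_pos.2 hr1).le]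
    exact mul_le_of_le_one_right (inv_pos.2 hr1).le hz
  have h1 := happ x y hxy (-s)
  have h2 := pow_le_pow_left₀ (norm_nonneg _) hz' 2
  rw [norm_smul, hx, hy, norm_neg, Real.norm_of_nonneg hs0.le] at h1
  nlinarith

end Plane

end BJ

theorem mainTheorem3 (X : Type*) [NormedAddCommGroup X] [NormedSpace ℝ X]
    (hdim : Module.finrank ℝ X = 2) (hpoly : BJ.IsPolyhedralSpace X) :
    List.TFAE
      [BJ.PropertyP1 X,
       BJ.EdgeCondition X,
       ∀ x ∈ Metric.sphere (0 : X) 1, BJ.LocalPropertyP x,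
       BJ.CApproxSymmetric X] := by
  tfae_have 1 → 2 := fun h => h.edgeCondition hdim
  tfae_have 2 → 1 := fun h => h.propertyP1 hdim
  tfae_have 1 → 3 := fun h x hx => h.localPropertyP hdim hpoly (mem_sphere_zero_iff_norm.1 hx)
  tfae_have 3 → 4 := fun h => BJ.cApproxSymmetric_of_localPropertyP hdim hpoly h
  tfae_have 4 → 1 := fun h => h.propertyP1 hdim
  tfae_finish
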